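/- Let $\Lambda$ be an Artin algebra, i.e. a ring that is an algebra over a commutative Artinian ring $k$ and is finitely generated as a $k$-module. Let $e\in\Lambda$ be an idempotent, and let $\operatorname{rad}\Lambda$ denote the Jacobson radical of $\Lambda$. For a ring $R$, let $\operatorname{findim}R$ denote the supremum of the projective dimensions of all finitely generated right $R$-modules of finite projective dimension. Assume that the right $\Lambda$-module $(1-e)\Lambda/(1-e)\operatorname{rad}\Lambda$ has projective dimension at most $1$. Then $$\operatorname{findim}\Lambda<\infty\quad\text{if and only if}\quad \operatorname{findim}e\Lambda e<\infty,$$ where $e\Lambda e$ is regarded as a ring with identity $e$. -/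

import Mathlib

open CategoryTheory

universe u v

/-- `findim R`, for right modules: the supremum of the projective dimensions of the finitely
generated right `R`-modules of finite projective dimension. Right `R`-modules are modules over
`Rᵐᵒᵖ`; the zero module has projective dimension `⊥`. -/
noncomputable def findim (R : Type u) [Ring R] : WithBot ℕ∞ :=
  sSup {d : WithBot ℕ∞ | ∃ M : ModuleCat.{u} Rᵐᵒᵖ,
    Module.Finite Rᵐᵒᵖ M ∧ projectiveDimension M = d ∧ d < ⊤}

section

variable {R : Type u} [Ring R]

/-- The radical of `R` as a right `R`-submodule of `R`: the intersection of all maximal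
right ideals. -/
def rightRad (R : Type u) [Ring R] : Submodule Rᵐᵒᵖ R := Module.jacobson Rᵐᵒᵖ R

/-- The right ideal `f I = {f * x | x ∈ I}`, for a right ideal `I`. -/
def mulRightIdeal (f : R) (I : Submodule Rᵐᵒᵖ R) : Submodule Rᵐᵒᵖ R :=
  I.map (LinearMap.mulLeft Rᵐᵒᵖ f)

/-- The right `R`-module `f R / f rad R`. -/
abbrev RightTop (f : R) : Type u :=
  mulRightIdeal f ⊤ ⧸ (mulRightIdeal f (rightRad R)).submoduleOf (mulRightIdeal f ⊤)

end

/-! Pass to left modules over `A = Λᵐᵒᵖ` and let `B` be the corner `eAe`. A finitely generated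
module `N` with `eN = 0` has finite length, and its composition factors are summands of the top
attached to `1 - e`; hence `N` has projective dimension at most 1. This is the hypothesis `hK`
below.

The exact functor `M ↦ eM` then compares dimensions both ways. If `M` is projective, `M/AeM` is
killed by `e`, so `AeM` is projective and so is `eM` over `B`; thus `pd eM ≤ pd M`
(`pdLT_cornerPart`). If `eM` is projective, some projective `Q` maps to `M` with kernel and cokernel
killed by `e`, so `pd M ≤ 2`; taking syzygies, `pd M ≤ pd eM + 2` (`pdLT_of_cornerPart`). As every
finitely generated `B`-module is some `eM` (`exists_cornerPart_equiv`), bounds transfer in both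
directions. -/

/-! ### Projective dimension in short exact sequences -/

/-- `PdLT A M n` says that the `A`-module `M` has projective dimension less than `n`. -/
abbrev PdLT (A : Type u) [Ring A] (M : Type u) [AddCommGroup M] [Module A M] (n : ℕ) : Prop :=
  HasProjectiveDimensionLT (ModuleCat.of A M) n

namespace PdLT

variable {A : Type u} [Ring A] {M N P : Type u} [AddCommGroup M] [Module A M]
  [AddCommGroup N] [Module A N] [AddCommGroup P] [Module A P]

theorem mono {m n : ℕ} (h : PdLT A M m) (hmn : m ≤ n) : PdLT A M n :=
  hasProjectiveDimensionLT_of_ge _ m n hmn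

theorem one_iff : PdLT A M 1 ↔ Module.Projective A M := by
  rw [IsProjective.iff_projective]
  exact projective_iff_hasProjectiveDimensionLT_one.symm

theorem of_equiv (e : M ≃ₗ[A] N) {n : ℕ} (h : PdLT A M n) : PdLT A N n :=
  hasProjectiveDimensionLT_of_iso e.toModuleIso n

theorem of_retract (i : M →ₗ[A] N) (p : N →ₗ[A] M) (h : p ∘ₗ i = LinearMap.id) {n : ℕ}
    (hN : PdLT A N n) : PdLT A M n :=
  Retract.hasProjectiveDimensionLT (X := ModuleCat.of A M) (Y := ModuleCat.of A N)
    ⟨ModuleCat.ofHom i, ModuleCat.ofHom p, by rw [← ModuleCat.ofHom_comp, h]; rfl⟩ n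

theorem of_subsingleton [Subsingleton M] (n : ℕ) : PdLT A M n := by
  have : PdLT A M 0 :=
    (ModuleCat.isZero_of_subsingleton (ModuleCat.of A M)).hasProjectiveDimensionLT_zero
  exact this.mono (Nat.zero_le n)

theorem shortExact (i : M →ₗ[A] N) (p : N →ₗ[A] P) (hi : Function.Injective i)
    (hp : Function.Surjective p) (hip : Function.Exact i p) :
    (ModuleCat.shortComplexOfCompEqZero i p hip.linearMap_comp_eq_zero).ShortExact :=
  ModuleCat.shortComplex_shortExact _ hip hi hp

theorem middle (p : N →ₗ[A] P) (hp : Function.Surjective p) {n : ℕ}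
    (h₁ : PdLT A (LinearMap.ker p) n) (h₃ : PdLT A P n) : PdLT A N n :=
  (shortExact _ p (LinearMap.ker p).injective_subtype hp
    (LinearMap.exact_subtype_ker_map p)).hasProjectiveDimensionLT_X₂ n h₁ h₃

theorem right (p : N →ₗ[A] P) (hp : Function.Surjective p) {n : ℕ}
    (h₁ : PdLT A (LinearMap.ker p) n) (h₂ : PdLT A N (n + 1)) : PdLT A P (n + 1) :=
  (shortExact _ p (LinearMap.ker p).injective_subtype hp
    (LinearMap.exact_subtype_ker_map p)).hasProjectiveDimensionLT_X₃ n h₁ h₂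

theorem left (p : N →ₗ[A] P) (hp : Function.Surjective p) {n : ℕ}
    (h₂ : PdLT A N n) (h₃ : PdLT A P (n + 1)) : PdLT A (LinearMap.ker p) n :=
  (shortExact _ p (LinearMap.ker p).injective_subtype hp
    (LinearMap.exact_subtype_ker_map p)).hasProjectiveDimensionLT_X₁ n h₂ h₃

end PdLT

theorem findim_lt_top_iff (R : Type u) [Ring R] :
    findim R < ⊤ ↔ ∃ N : ℕ, ∀ (M : Type u) [AddCommGroup M] [Module Rᵐᵒᵖ M]
      [Module.Finite Rᵐᵒᵖ M] (n : ℕ), PdLT Rᵐᵒᵖ M n → PdLT Rᵐᵒᵖ M N := by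
  constructor
  · intro h
    obtain ⟨N, hN⟩ : ∃ N : ℕ, findim R ≤ N := by
      generalize findim R = d at h
      induction d with
      | bot => exact ⟨0, bot_le⟩
      | coe d =>
        induction d with
        | top => exact absurd h (lt_irrefl _)
        | coe d => exact ⟨d, le_rfl⟩
    -- `PdLT` is a strict bound, so dimension at most `N` reads `PdLT` at `N + 1`.
    refine ⟨N + 1, fun M _ _ _ n hn ↦ ?_⟩
    refine (projectiveDimension_le_iff _ N).1 ((le_sSup ?_).trans hN)
    refine ⟨ModuleCat.of Rᵐᵒᵖ M, ‹_›, rfl, ?_⟩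
    exact (projectiveDimension_lt_iff.2 hn).trans_le le_top
  · rintro ⟨N, hN⟩
    refine lt_of_le_of_lt (b := ((N : ℕ) : WithBot ℕ∞)) (sSup_le ?_) ?_
    · rintro d ⟨M, _, rfl, hd⟩
      obtain ⟨n, hn⟩ := (projectiveDimension_ne_top_iff M).1 hd.ne
      exact (projectiveDimension_lt_iff.2 (hN M (n + 1) hn)).le
    · exact WithBot.coe_lt_coe.2 (ENat.natCast_lt_top N)

/-! ### The corner functor `M ↦ eM` -/

section Corner

variable {A B : Type u} [Ring A] [Ring B] (f : B →ₙ+* A)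

theorem map_one_mul_map (b : B) : f 1 * f b = f b := by rw [← map_mul, one_mul]

theorem map_mul_map_one (b : B) : f b * f 1 = f b := by rw [← map_mul, mul_one]

/-- The subgroup `e M` of an `A`-module `M`, for the idempotent `e = f 1`. -/
def cornerPart (M : Type u) [AddCommGroup M] [Module A M] : AddSubgroup M where
  carrier := {m | f 1 • m = m}
  add_mem' {x y} hx hy := by
    change f 1 • (x + y) = x + y
    rw [smul_add, show f 1 • x = x from hx, show f 1 • y = y from hy]
  zero_mem' := smul_zero _
  neg_mem' {x} hx := by
    change f 1 • (-x) = -x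
    rw [smul_neg, show f 1 • x = x from hx]

variable {M N : Type u} [AddCommGroup M] [Module A M] [AddCommGroup N] [Module A N]

theorem cornerPart.one_smul (m : cornerPart f M) : f 1 • (m : M) = m := m.2

theorem map_smul_mem_cornerPart (b : B) (m : M) : f b • m ∈ cornerPart f M := by
  change f 1 • f b • m = f b • m
  rw [smul_smul, map_one_mul_map]

instance : Module B (cornerPart f M) where
  smul b m := ⟨f b • (m : M), map_smul_mem_cornerPart f b (m : M)⟩
  one_smul m := Subtype.ext m.2
  mul_smul a b m := Subtype.ext (by
    change f (a * b) • (m : M) = f a • f b • (m : M)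
    rw [map_mul, mul_smul])
  smul_zero a := Subtype.ext (smul_zero (f a))
  smul_add a x y := Subtype.ext (smul_add (f a) (x : M) y)
  add_smul a b x := Subtype.ext (by
    change f (a + b) • (x : M) = f a • (x : M) + f b • (x : M)
    rw [map_add, add_smul])
  zero_smul x := Subtype.ext (by
    change f 0 • (x : M) = 0
    rw [map_zero, zero_smul])

@[simp]
theorem cornerPart.coe_smul (b : B) (m : cornerPart f M) :
    ((b • m : cornerPart f M) : M) = f b • (m : M) := rfl

/-- The `B`-linear map `e M → e N` induced by an `A`-linear map `M → N`. -/
def cornerMap (g : M →ₗ[A] N) : cornerPart f M →ₗ[B] cornerPart f N where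
  toFun m := ⟨g m, by
    change f 1 • g m = g m
    rw [← map_smul, cornerPart.one_smul]⟩
  map_add' x y := Subtype.ext (map_add g (x : M) y)
  map_smul' b x := Subtype.ext (map_smul g (f b) (x : M))

theorem cornerMap_surjective (g : M →ₗ[A] N) (hg : Function.Surjective g) :
    Function.Surjective (cornerMap f g) := by
  intro n
  obtain ⟨m, hm⟩ := hg n
  refine ⟨⟨f 1 • m, map_smul_mem_cornerPart f 1 m⟩, Subtype.ext ?_⟩
  change g (f 1 • m) = n
  rw [map_smul, hm, cornerPart.one_smul]

/-- The functor `M ↦ e M` commutes with kernels. -/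
def cornerKerEquiv (g : M →ₗ[A] N) :
    LinearMap.ker (cornerMap f g) ≃ₗ[B] cornerPart f (LinearMap.ker g) where
  toFun x := ⟨⟨(x : cornerPart f M), congrArg Subtype.val x.2⟩,
    Subtype.ext (cornerPart.one_smul f (x : cornerPart f M))⟩
  invFun y := ⟨⟨(y : LinearMap.ker g), congrArg Subtype.val y.2⟩,
    Subtype.ext (y : LinearMap.ker g).2⟩
  map_add' _ _ := rfl
  map_smul' _ _ := rfl
  left_inv _ := rfl
  right_inv _ := rfl

/-- The submodule `A e M` of `M`. -/
def cornerSpan (M : Type u) [AddCommGroup M] [Module A M] : Submodule A M :=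
  Submodule.span A (cornerPart f M : Set M)

theorem map_one_smul_quotient_eq_zero {S : Submodule A M} (hS : ∀ m : cornerPart f M, (m : M) ∈ S)
    (x : M ⧸ S) : f 1 • x = 0 := by
  obtain ⟨m, rfl⟩ := S.mkQ_surjective x
  rw [← map_smul]
  exact (Submodule.Quotient.mk_eq_zero S).2 (hS ⟨_, map_smul_mem_cornerPart f 1 m⟩)

/-- `f : B → A` identifies `B` with the corner ring `e A e`, for the idempotent `e = f 1`. -/
structure IsCornerHom : Prop where
  injective : Function.Injective f
  exists_map_eq (a : A) : ∃ b, f b = f 1 * a * f 1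

namespace IsCornerHom

variable {f} (hf : IsCornerHom f)

/-- The map `a ↦ e a e` from `A` to the corner ring. -/
noncomputable def compress : A →+ B where
  toFun a := (hf.exists_map_eq a).choose
  map_zero' := hf.injective (by
    rw [(hf.exists_map_eq 0).choose_spec, mul_zero, zero_mul, map_zero])
  map_add' x y := hf.injective (by
    rw [map_add, (hf.exists_map_eq x).choose_spec, (hf.exists_map_eq y).choose_spec,
      (hf.exists_map_eq (x + y)).choose_spec, mul_add, add_mul])

theorem map_compress (a : A) : f (hf.compress a) = f 1 * a * f 1 :=
  (hf.exists_map_eq a).choose_spec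

theorem compress_map (b : B) : hf.compress (f b) = b :=
  hf.injective (by rw [map_compress, map_one_mul_map, map_mul_map_one])

theorem compress_map_mul (b : B) (a : A) : hf.compress (f b * a) = b * hf.compress a :=
  hf.injective (by
    rw [map_mul f, map_compress, map_compress, ← mul_assoc, ← mul_assoc, ← mul_assoc,
      map_one_mul_map, map_mul_map_one])

theorem compress_mul_map (b : B) (a : A) : hf.compress (a * f b) = hf.compress a * b :=
  hf.injective (by
    rw [map_mul f, map_compress, map_compress, mul_assoc, mul_assoc, mul_assoc, mul_assoc,
      map_one_mul_map, map_mul_map_one])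

theorem map_compress_smul (a : A) (m : cornerPart f M) :
    f (hf.compress a) • (m : M) = f 1 • a • (m : M) := by
  rw [map_compress, mul_smul, mul_smul, cornerPart.one_smul]

theorem coe_linearCombination_mapRange (v : cornerPart f M →₀ A) :
    (Finsupp.linearCombination B id (v.mapRange hf.compress (map_zero _)) : cornerPart f M)
      = f 1 • Finsupp.linearCombination A (Subtype.val : cornerPart f M → M) v := by
  induction v using Finsupp.induction_linear with
  | zero => simp
  | add v w hv hw =>
    rw [Finsupp.mapRange_add (map_add _), map_add, map_add, smul_add, ← hv, ← hw]
    rfl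
  | single m a =>
    simp [map_compress_smul]

-- A section of the free cover of `AeM` on the set `eM` restricts to `eM`; compressing its
-- coefficients to `B` makes it a section of the free `B`-cover of `eM`.
include hf in
theorem projective_cornerPart_of_cornerSpan (h : Module.Projective A (cornerSpan f M)) :
    Module.Projective B (cornerPart f M) := by
  let L : (cornerPart f M →₀ A) →ₗ[A] cornerSpan f M :=
    (Finsupp.linearCombination A (Subtype.val : cornerPart f M → M)).codRestrict _ (fun v ↦ by
      have h := LinearMap.mem_range_self
        (Finsupp.linearCombination A (Subtype.val : cornerPart f M → M)) v
      rw [Finsupp.range_linearCombination, Subtype.range_coe] at h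
      exact h)
  have hL : Function.Surjective L := by
    rintro ⟨x, hx⟩
    have h : x ∈ LinearMap.range
        (Finsupp.linearCombination A (Subtype.val : cornerPart f M → M)) := by
      rw [Finsupp.range_linearCombination, Subtype.range_coe]
      exact hx
    obtain ⟨v, hv⟩ := h
    exact ⟨v, Subtype.ext hv⟩
  obtain ⟨s, hs⟩ := Module.projective_lifting_property L LinearMap.id hL
  let s' : cornerPart f M →ₗ[B] (cornerPart f M →₀ B) :=
    { toFun x := (s ⟨x, Submodule.subset_span x.2⟩).mapRange hf.compress (map_zero _)
      map_add' x y := by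
        rw [← Finsupp.mapRange_add (map_add _), ← map_add]
        rfl
      map_smul' b x := by
        have : (⟨(b • x : cornerPart f M), Submodule.subset_span (b • x).2⟩ : cornerSpan f M)
            = f b • ⟨(x : M), Submodule.subset_span x.2⟩ := rfl
        rw [this, map_smul]
        ext y
        simp [compress_map_mul] }
  refine ⟨s', fun x ↦ Subtype.ext ?_⟩
  refine (hf.coe_linearCombination_mapRange _).trans ?_
  have := congrArg Subtype.val
    (LinearMap.congr_fun hs ⟨(x : M), Submodule.subset_span x.2⟩)
  change Finsupp.linearCombination A (Subtype.val : cornerPart f M → M) _ = (x : M) at this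
  rw [this, cornerPart.one_smul]

-- The noetherian hypothesis lets finitely many elements of `eM` generate `AeM`. They generate `eM`
-- over `B`, because `e a y = (e a e) y` for `y` in `eM`.
include hf in
theorem finite_cornerPart [IsNoetherianRing A] [Module.Finite A M] :
    Module.Finite B (cornerPart f M) := by
  obtain ⟨s, hs, hspan⟩ := (Submodule.fg_span_iff_fg_span_finset_subset
    (cornerPart f M : Set M)).1 (IsNoetherian.noetherian (cornerSpan f M))
  have key : ∀ y ∈ Submodule.span A (s : Set M), ∀ a : A,
      (⟨f 1 • a • y, map_smul_mem_cornerPart f 1 _⟩ : cornerPart f M) ∈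
        Submodule.span B ((Subtype.val : cornerPart f M → M) ⁻¹' s) := by
    intro y hy
    induction hy using Submodule.span_induction with
    | mem y hy =>
      intro a
      have : (⟨f 1 • a • y, map_smul_mem_cornerPart f 1 _⟩ : cornerPart f M)
          = hf.compress a • ⟨y, hs hy⟩ :=
        Subtype.ext (hf.map_compress_smul a ⟨y, hs hy⟩).symm
      rw [this]
      exact Submodule.smul_mem _ _ (Submodule.subset_span hy)
    | zero =>
      intro a
      convert Submodule.zero_mem _
      simp
    | add x y _ _ hx hy =>
      intro a
      convert Submodule.add_mem _ (hx a) (hy a)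
      simp
    | smul c y _ hy =>
      intro a
      convert hy (a * c) using 3
      rw [mul_smul]
  refine ⟨Submodule.fg_def.2 ⟨_, s.finite_toSet.preimage Subtype.val_injective.injOn,
    eq_top_iff.2 fun x _ ↦ ?_⟩⟩
  have := key x (hspan ▸ Submodule.subset_span x.2) 1
  convert this
  rw [_root_.one_smul, cornerPart.one_smul]

end IsCornerHom

variable {f}

/-- The `A`-linear map `Aⁿ → M` extending a `B`-linear map `Bⁿ → e M`. -/
def extendCorner {n : ℕ} (φ : (Fin n → B) →ₗ[B] cornerPart f M) : (Fin n → A) →ₗ[A] M :=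
  Fintype.linearCombination A (fun j ↦ (φ (Pi.single j 1) : M))

theorem extendCorner_single {n : ℕ} (φ : (Fin n → B) →ₗ[B] cornerPart f M) (j : Fin n) (a : A) :
    extendCorner φ (Pi.single j a) = a • (φ (Pi.single j 1) : M) := by
  classical
  simp [extendCorner, Fintype.linearCombination_apply_single]

theorem extendCorner_map {n : ℕ} (φ : (Fin n → B) →ₗ[B] cornerPart f M) (b : Fin n → B) :
    extendCorner φ (fun j ↦ f (b j)) = φ b := by
  classical
  have : b = ∑ j, b j • (Pi.single j 1 : Fin n → B) := by
    simpa using pi_eq_sum_univ' b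
  conv_rhs => rw [this]
  simp [extendCorner, Fintype.linearCombination_apply]

/-- The `B`-linear map `Bⁿ → e Aⁿ`. -/
def mapPi (f : B →ₙ+* A) (n : ℕ) : (Fin n → B) →ₗ[B] cornerPart f (Fin n → A) where
  toFun b := ⟨fun j ↦ f (b j), funext fun j ↦ map_one_mul_map f (b j)⟩
  map_add' x y := Subtype.ext (funext fun j ↦ map_add f (x j) (y j))
  map_smul' c x := Subtype.ext (funext fun j ↦ map_mul f c (x j))

end Corner

/-! ### Comparing projective dimensions over `A` and `B` -/

theorem IsFiniteLength.pdLT_of_simple {A : Type u} [Ring A] (e : A) {n : ℕ}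
    (hs : ∀ (T : Type u) [AddCommGroup T] [Module A T] [IsSimpleModule A T],
      (∀ t : T, e • t = 0) → PdLT A T n)
    {N : Type u} [AddCommGroup N] [Module A N] (hN : IsFiniteLength A N)
    (he : ∀ x : N, e • x = 0) : PdLT A N n := by
  induction hN with
  | of_subsingleton => exact .of_subsingleton n
  | @of_simple_quotient M _ _ S _ _ ih =>
    refine PdLT.middle S.mkQ S.mkQ_surjective ?_ (hs _ fun t ↦ ?_)
    · rw [Submodule.ker_mkQ]
      exact ih fun x ↦ Subtype.ext (he x)
    · obtain ⟨m, rfl⟩ := S.mkQ_surjective t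
      rw [← map_smul, he, map_zero]

section Corner

variable {A B : Type u} [Ring A] [Ring B] {f : B →ₙ+* A}
  {M : Type u} [AddCommGroup M] [Module A M]

namespace IsCornerHom

variable (hf : IsCornerHom f)

include hf in
theorem projective_cornerPart
    (hK : ∀ (N : Type u) [AddCommGroup N] [Module A N] [Module.Finite A N],
      (∀ x : N, f 1 • x = 0) → PdLT A N 2)
    [Module.Finite A M] (hM : Module.Projective A M) :
    Module.Projective B (cornerPart f M) := by
  refine hf.projective_cornerPart_of_cornerSpan (PdLT.one_iff.1 ?_)
  have := PdLT.left (cornerSpan f M).mkQ (cornerSpan f M).mkQ_surjective (n := 1)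
    (PdLT.one_iff.2 hM)
    (hK _ (map_one_smul_quotient_eq_zero f fun m ↦ Submodule.subset_span m.2))
  rwa [Submodule.ker_mkQ] at this

include hf in
theorem pdLT_cornerPart [IsNoetherianRing A]
    (hK : ∀ (N : Type u) [AddCommGroup N] [Module A N] [Module.Finite A N],
      (∀ x : N, f 1 • x = 0) → PdLT A N 2) (n : ℕ) :
    ∀ (M : Type u) [AddCommGroup M] [Module A M] [Module.Finite A M],
      PdLT A M n → PdLT B (cornerPart f M) n := by
  induction n with
  | zero =>
    intro M _ _ _ h
    have : Subsingleton M :=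
      ModuleCat.subsingleton_of_isZero ((hasProjectiveDimensionLT_zero_iff_isZero _).1 h)
    exact .of_subsingleton 0
  | succ n ih =>
    intro M _ _ _ h
    cases n with
    | zero => exact PdLT.one_iff.2 (hf.projective_cornerPart hK (PdLT.one_iff.1 h))
    | succ n =>
      obtain ⟨m, p, hp⟩ := Module.Finite.exists_fin' A M
      have hfree : ∀ k, PdLT A (Fin m → A) (k + 1) := fun k ↦
        (PdLT.one_iff.2 inferInstance).mono (Nat.le_add_left 1 k)
      exact PdLT.right (cornerMap f p) (cornerMap_surjective f p hp)
        ((ih _ (PdLT.left p hp (hfree n) h)).of_equiv (cornerKerEquiv f p).symm)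
        ((PdLT.one_iff.2 (hf.projective_cornerPart hK inferInstance)).mono
          (Nat.le_add_left 1 (n + 1)))

include hf in
theorem pdLT_three_of_projective_cornerPart [IsNoetherianRing A]
    (hK : ∀ (N : Type u) [AddCommGroup N] [Module A N] [Module.Finite A N],
      (∀ x : N, f 1 • x = 0) → PdLT A N 2)
    [Module.Finite A M] (hM : Module.Projective B (cornerPart f M)) : PdLT A M 3 := by
  have := hf.finite_cornerPart (M := M)
  obtain ⟨n, p, hp⟩ := Module.Finite.exists_fin' B (cornerPart f M)
  obtain ⟨i, hi⟩ := Module.projective_lifting_property p LinearMap.id hp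
  replace hi (x) : p (i x) = x := LinearMap.congr_fun hi x
  -- `U` extends the idempotent `i ∘ p` of `Bⁿ` to an idempotent of `Aⁿ`; its range is the
  -- projective module `Q`, playing the role of `Ae ⊗ eM`.
  let U : (Fin n → A) →ₗ[A] (Fin n → A) := extendCorner (mapPi f n ∘ₗ i ∘ₗ p)
  let q : (Fin n → A) →ₗ[A] M := extendCorner p
  have hU (b : Fin n → B) : U (fun j ↦ f (b j)) = fun j ↦ f (i (p b) j) := extendCorner_map _ b
  have hq (b : Fin n → B) : q (fun j ↦ f (b j)) = p b := extendCorner_map _ b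
  have hUU (v) : U (U v) = U v := by
    have : U ∘ₗ U = U := by
      refine LinearMap.pi_ext fun j a ↦ ?_
      have h1 : U (Pi.single j a) = a • fun k ↦ f (i (p (Pi.single j 1)) k) :=
        extendCorner_single _ j a
      rw [LinearMap.comp_apply, h1, map_smul, hU, hi]
    exact LinearMap.congr_fun this v
  -- The entries of `U v` lie in `Ae`, so those of `e U v` lie in `eAe` and come from `Bⁿ`.
  have hUe (v) (k) : U v k * f 1 = U v k := by
    have : ∀ v, U v k = ∑ j, v j * f (i (p (Pi.single j 1)) k) := fun v ↦ by
      simp only [U, extendCorner]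
      simp only [Fintype.linearCombination_apply, Finset.sum_apply, Pi.smul_apply, smul_eq_mul]
      rfl
    rw [this, Finset.sum_mul]
    refine Finset.sum_congr rfl fun j _ ↦ ?_
    rw [mul_assoc, map_mul_map_one]
  have hQ : PdLT A (LinearMap.range U) 1 := PdLT.one_iff.2 <|
    Module.Projective.of_split (LinearMap.range U).subtype U.rangeRestrict (by
      ext1 ⟨_, v, rfl⟩
      exact Subtype.ext (hUU v))
  let q' : LinearMap.range U →ₗ[A] M := q ∘ₗ (LinearMap.range U).subtype
  -- On `eQ` the map to `M` is injective: if `b` in `Bⁿ` represents `e U v` and `p b = 0`, then `e U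
  -- v = U (e U v)` is the image of `i (p b) = 0`.
  have hker (x : LinearMap.ker q') : f 1 • x = 0 := by
    obtain ⟨⟨_, v, rfl⟩, hx⟩ := x
    refine Subtype.ext (Subtype.ext ?_)
    change f 1 • U v = 0
    have hx' : q (U v) = 0 := hx
    have h1 : f 1 • U v = fun j ↦ f (hf.compress (U v j)) := by
      ext j
      rw [hf.map_compress, mul_assoc, hUe]
      rfl
    have h2 : p (fun j ↦ hf.compress (U v j)) = 0 := Subtype.ext (by
      rw [← hq, ← h1, map_smul, hx', smul_zero]
      rfl)
    rw [← hUU, ← map_smul, h1, hU, h2, map_zero]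
    ext j
    exact map_zero f
  have hrange (m : cornerPart f M) : (m : M) ∈ LinearMap.range q' := by
    refine ⟨⟨U (fun j ↦ f (i m j)), LinearMap.mem_range_self _ _⟩, ?_⟩
    change q (U _) = _
    rw [hU, hi, hq, hi]
  refine PdLT.middle (LinearMap.range q').mkQ (Submodule.mkQ_surjective _) ?_
    ((hK _ (map_one_smul_quotient_eq_zero f hrange)).mono (Nat.le_succ 2))
  rw [Submodule.ker_mkQ]
  refine PdLT.right q'.rangeRestrict q'.surjective_rangeRestrict ?_
    (hQ.mono (Nat.le_add_left 1 2))
  rw [LinearMap.ker_rangeRestrict]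
  exact hK _ hker

include hf in
theorem pdLT_of_cornerPart [IsNoetherianRing A]
    (hK : ∀ (N : Type u) [AddCommGroup N] [Module A N] [Module.Finite A N],
      (∀ x : N, f 1 • x = 0) → PdLT A N 2) (n : ℕ) :
    ∀ (M : Type u) [AddCommGroup M] [Module A M] [Module.Finite A M],
      PdLT B (cornerPart f M) (n + 1) → PdLT A M (n + 3) := by
  induction n with
  | zero =>
    intro M _ _ _ h
    exact hf.pdLT_three_of_projective_cornerPart hK (PdLT.one_iff.1 h)
  | succ n ih =>
    intro M _ _ _ h
    obtain ⟨m, p, hp⟩ := Module.Finite.exists_fin' A M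
    refine PdLT.right p hp (ih _ ?_) ((PdLT.one_iff.2 inferInstance).mono (by lia))
    refine PdLT.of_equiv (cornerKerEquiv f p)
      (PdLT.left (cornerMap f p) (cornerMap_surjective f p hp) ?_ h)
    exact (PdLT.one_iff.2 (hf.projective_cornerPart hK inferInstance)).mono (by lia)

include hf in
/-- Every finitely generated module over the corner ring is the corner of a finitely generated
module. -/
theorem exists_cornerPart_equiv (X : Type u) [AddCommGroup X] [Module B X] [Module.Finite B X] :
    ∃ (M : Type u) (_ : AddCommGroup M) (_ : Module A M),
      Module.Finite A M ∧ Nonempty (X ≃ₗ[B] cornerPart f M) := by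
  obtain ⟨n, p, hp⟩ := Module.Finite.exists_fin' B X
  -- `V` is the largest `A`-submodule of `Aⁿ` whose compression to `Bⁿ` is killed by `p`; it meets
  -- the image of `Bⁿ` exactly in that of `ker p`.
  let V : Submodule A (Fin n → A) :=
    { carrier := {v | ∀ a : A, p (fun j ↦ hf.compress (a * v j)) = 0}
      add_mem' {v w} hv hw a := by
        have : (fun j ↦ hf.compress (a * (v + w) j))
            = (fun j ↦ hf.compress (a * v j)) + fun j ↦ hf.compress (a * w j) := by
          ext j
          simp [mul_add]
        rw [this, map_add, hv a, hw a, add_zero]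
      zero_mem' a := by
        convert map_zero p
        simp
      smul_mem' c v hv a := by
        convert hv (a * c) using 4
        rw [Pi.smul_apply, smul_eq_mul, mul_assoc] }
  have hV (v : Fin n → A) : v ∈ V ↔ ∀ a : A, p (fun j ↦ hf.compress (a * v j)) = 0 := Iff.rfl
  refine ⟨(Fin n → A) ⧸ V, inferInstance, inferInstance, inferInstance, ?_⟩
  let φ : (Fin n → B) →ₗ[B] cornerPart f ((Fin n → A) ⧸ V) := cornerMap f V.mkQ ∘ₗ mapPi f n
  have hφ : Function.Surjective φ := by
    intro y
    obtain ⟨⟨v, hv⟩, rfl⟩ := cornerMap_surjective f V.mkQ V.mkQ_surjective y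
    refine ⟨fun j ↦ hf.compress (v j), Subtype.ext ?_⟩
    refine (Submodule.Quotient.eq V).2 fun a ↦ ?_
    convert map_zero p using 2
    ext j
    refine hf.injective ?_
    have hvj : f 1 * v j = v j := congrFun hv j
    change f (hf.compress (a * (f (hf.compress (v j)) - v j))) = f 0
    rw [hf.map_compress, hf.map_compress, hvj, mul_assoc, mul_assoc, sub_mul, mul_assoc,
      ← map_mul, one_mul, sub_self, mul_zero, mul_zero, map_zero]
  have hker : LinearMap.ker φ = LinearMap.ker p := by
    ext b
    have h0 : φ b = 0 ↔ (fun j ↦ f (b j)) ∈ V := by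
      rw [← Submodule.Quotient.mk_eq_zero]
      exact Subtype.ext_iff
    rw [LinearMap.mem_ker, LinearMap.mem_ker, h0, hV]
    have h1 (a : A) : p (fun j ↦ hf.compress (a * f (b j))) = hf.compress a • p b := by
      rw [← map_smul]
      congr 1
      ext j
      exact hf.compress_mul_map (b j) a
    constructor
    · intro h
      have := h (f 1)
      rwa [h1, hf.compress_map, one_smul] at this
    · intro h a
      rw [h1, h, smul_zero]
  exact ⟨(p.quotKerEquivOfSurjective hp).symm ≪≫ₗ
    Submodule.quotEquivOfEq _ _ hker.symm ≪≫ₗ φ.quotKerEquivOfSurjective hφ⟩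

include hf in
theorem bounded_pdLT_iff [IsNoetherianRing A]
    (hK : ∀ (N : Type u) [AddCommGroup N] [Module A N] [Module.Finite A N],
      (∀ x : N, f 1 • x = 0) → PdLT A N 2) :
    (∃ N : ℕ, ∀ (M : Type u) [AddCommGroup M] [Module A M] [Module.Finite A M] (n : ℕ),
      PdLT A M n → PdLT A M N) ↔
    ∃ N : ℕ, ∀ (X : Type u) [AddCommGroup X] [Module B X] [Module.Finite B X] (n : ℕ),
      PdLT B X n → PdLT B X N := by
  constructor
  · rintro ⟨N, hN⟩
    -- Finite dimension of `X = eM` only serves to make that of `M` finite; the bound `N` then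
    -- applies to `M` and descends unchanged to `eM`.
    refine ⟨N, fun X _ _ _ n hX ↦ ?_⟩
    obtain ⟨M, _, _, _, ⟨g⟩⟩ := hf.exists_cornerPart_equiv X
    have hM := hf.pdLT_of_cornerPart hK n M ((hX.of_equiv g).mono (Nat.le_succ n))
    exact (hf.pdLT_cornerPart hK N M (hN M _ hM)).of_equiv g.symm
  · rintro ⟨N, hN⟩
    refine ⟨N + 3, fun M _ _ _ n hM ↦ ?_⟩
    have := hf.finite_cornerPart (M := M)
    exact hf.pdLT_of_cornerPart hK N M
      ((hN _ n (hf.pdLT_cornerPart hK n M hM)).mono (Nat.le_succ N))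

end IsCornerHom

end Corner
open MulOpposite

/-! ### Simple modules killed by `e` -/

section RightTop

variable {R : Type u} [Ring R]

/-- The canonical surjection `R → f R / f rad R`. -/
def toRightTop (f : R) : R →ₗ[Rᵐᵒᵖ] RightTop f :=
  Submodule.mkQ _ ∘ₗ (LinearMap.mulLeft Rᵐᵒᵖ f).codRestrict (mulRightIdeal f ⊤)
    (fun x ↦ ⟨x, trivial, rfl⟩)

theorem toRightTop_surjective (f : R) : Function.Surjective (toRightTop f) := by
  refine (Submodule.mkQ_surjective _).comp ?_
  rintro ⟨_, x, -, rfl⟩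
  exact ⟨x, rfl⟩

theorem toRightTop_eq_zero_iff (f x : R) :
    toRightTop f x = 0 ↔ ∃ r ∈ rightRad R, f * r = f * x :=
  Submodule.Quotient.mk_eq_zero _

theorem isSemisimpleModule_rightTop [IsArtinian Rᵐᵒᵖ R] (f : R) :
    IsSemisimpleModule Rᵐᵒᵖ (RightTop f) := by
  have : IsSemisimpleModule Rᵐᵒᵖ (R ⧸ rightRad R) :=
    (IsArtinian.isSemisimpleModule_iff_jacobson _ _).2 (Module.jacobson_quotient_jacobson Rᵐᵒᵖ R)
  let g : (R ⧸ rightRad R) →ₗ[Rᵐᵒᵖ] RightTop f :=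
    (rightRad R).liftQ (toRightTop f) fun x hx ↦ (toRightTop_eq_zero_iff f x).2 ⟨x, hx, rfl⟩
  refine IsSemisimpleModule.of_surjective g fun y ↦ ?_
  obtain ⟨x, rfl⟩ := toRightTop_surjective f y
  exact ⟨Submodule.Quotient.mk x, rfl⟩

/-- A simple right module `T` with `T e = 0` is a direct summand of the top of `(1 - e) R`. -/
theorem pdLT_of_isSimpleModule_of_rightTop [IsArtinian Rᵐᵒᵖ R] {e : R} {n : ℕ}
    (hpd : PdLT Rᵐᵒᵖ (RightTop (1 - e)) n) (T : Type u) [AddCommGroup T] [Module Rᵐᵒᵖ T]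
    [IsSimpleModule Rᵐᵒᵖ T] (hT : ∀ t : T, op e • t = 0) : PdLT Rᵐᵒᵖ T n := by
  have := isSemisimpleModule_rightTop (1 - e)
  have := IsSimpleModule.nontrivial Rᵐᵒᵖ T
  obtain ⟨t, ht⟩ := exists_ne (0 : T)
  let h : R →ₗ[Rᵐᵒᵖ] T :=
    { toFun x := op x • t
      map_add' x y := by rw [MulOpposite.op_add, add_smul]
      map_smul' a x := by
        change op (x * a.unop) • t = a • op x • t
        rw [op_mul, mul_smul, op_unop] }
  have hrad (r : R) (hr : r ∈ rightRad R) : op r • t = 0 :=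
    IsSemisimpleModule.jacobson_le_ker _ _ _ _ h hr
  have hf (x : R) : op ((1 - e) * x) • t = op x • t := by
    rw [op_mul, mul_smul, MulOpposite.op_sub, sub_smul, hT, sub_zero, op_one, one_smul]
  -- Since `te = 0`, the product `tx` depends only on `(1 - e)x`, and the radical kills the simple
  -- module `T`.
  have hker : LinearMap.ker (toRightTop (1 - e)) ≤ LinearMap.ker h := by
    intro x hx
    obtain ⟨r, hr, hrx⟩ := (toRightTop_eq_zero_iff _ x).1 hx
    change op x • t = 0
    rw [← hf, ← hrx, hf, hrad r hr]
  let g : RightTop (1 - e) →ₗ[Rᵐᵒᵖ] T :=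
    (LinearMap.ker (toRightTop (1 - e))).liftQ h hker ∘ₗ
      ((toRightTop (1 - e)).quotKerEquivOfSurjective (toRightTop_surjective _)).symm.toLinearMap
  have hg : g (toRightTop (1 - e) 1) = t := by
    have : ((toRightTop (1 - e)).quotKerEquivOfSurjective (toRightTop_surjective _)).symm
        (toRightTop (1 - e) 1) = Submodule.Quotient.mk 1 := by
      rw [LinearEquiv.symm_apply_eq]
      rfl
    change (LinearMap.ker (toRightTop (1 - e))).liftQ h hker _ = t
    erw [this]
    exact one_smul _ t
  have hgs : Function.Surjective g := LinearMap.surjective_of_ne_zero fun h0 ↦ ht (by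
    rw [← hg, h0, LinearMap.zero_apply])
  obtain ⟨i, hi⟩ := IsSemisimpleModule.lifting_property g hgs LinearMap.id
  exact PdLT.of_retract i g hi hpd

end RightTop

/-! ### Application to Artin algebras -/

/-- The inclusion of the opposite of the corner ring `e R e` into the opposite of `R`. -/
def IsIdempotentElem.cornerOpHom {R : Type u} [Ring R] {e : R} (he : IsIdempotentElem e) :
    he.Cornerᵐᵒᵖ →ₙ+* Rᵐᵒᵖ where
  toFun x := op (x.unop : he.Corner).1
  map_zero' := rfl
  map_add' _ _ := rfl
  map_mul' _ _ := rfl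

theorem IsIdempotentElem.isCornerHom_cornerOpHom {R : Type u} [Ring R] {e : R}
    (he : IsIdempotentElem e) : IsCornerHom he.cornerOpHom where
  injective _ _ h := unop_injective (Subtype.ext (op_injective h))
  exists_map_eq a := ⟨op ⟨e * a.unop * e, a.unop, rfl⟩, unop_injective (mul_assoc e a.unop e)⟩

theorem mainTheorem11 {k : Type v} [CommRing k] [IsArtinianRing k]
    {Λ : Type u} [Ring Λ] [Algebra k Λ] [Module.Finite k Λ]
    {e : Λ} (he : IsIdempotentElem e)
    (hpd : projectiveDimension (ModuleCat.of Λᵐᵒᵖ (RightTop (1 - e))) ≤ 1) :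
    findim Λ < ⊤ ↔ findim he.Corner < ⊤ := by
  have : Module.Finite k Λᵐᵒᵖ := Module.Finite.equiv (opLinearEquiv k)
  have : IsArtinianRing Λᵐᵒᵖ := IsArtinianRing.of_finite k Λᵐᵒᵖ
  have : IsArtinian Λᵐᵒᵖ Λ := isArtinian_of_tower k inferInstance
  rw [findim_lt_top_iff, findim_lt_top_iff]
  refine he.isCornerHom_cornerOpHom.bounded_pdLT_iff fun N _ _ _ hN ↦ ?_
  exact IsFiniteLength.pdLT_of_simple (op e)
    (pdLT_of_isSimpleModule_of_rightTop ((projectiveDimension_le_iff _ 1).1 hpd))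
    (isFiniteLength_iff_isNoetherian_isArtinian.2 ⟨inferInstance, inferInstance⟩) hN
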